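/- Let $g,d_H\ge 0$ be real numbers and $k\in\mathbb N$. For $L\in\mathbb N$ consider the chain of qubits $\Lambda=\{1,\dots,L\}$ with $\mathrm{dist}(i,j)=|i-j|$, and Hamiltonians $H^{(L)}=\sum_{X\subseteq\Lambda}h_X$, where each $h_X$ is Hermitian and acts on the qubits of $X$, such that (i) $\sum_{X\ni j}\|h_X\|\le g$ for every $j\in\Lambda$ (operator norm); (ii) $h_X=0$ if $|X|>k$; (iii) $h_X=0$ if $X$ contains two sites at distance greater than $d_H$. Call these Hamiltonians (for all $L$) $(g,k,d_H)$-local, and put $U^{(L)}=e^{-iH^{(L)}\tau}$. For $\tau\ge 0$ we say that the Lieb-Robinson (LR) bound with velocity $v$, length $\xi$ and prefactor $C$ holds at time $\tau$ if, for every $L$, every $(g,k,d_H)$-local $H^{(L)}$, all sites $j,j'$ and all single-site observables $O_j,O_{j'}$ with $\|O_j\|=\|O_{j'}\|=1$, $$\big\|[U^{(L)\dagger}O_jU^{(L)},O_{j'}]\big\|\le C\,e^{-(\mathrm{dist}(j,j')-v\tau)/\xi}.$$ For unitaries $U,V$ on $\Lambda$, the local cost is $C^{(j)}_{\mathrm{LHST}}(U,V)=1-\mathrm{Tr}[\Pi_j\,\rho_{AB}(U,V)]$,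 where $A,B$ are two copies of $\Lambda$, $|\Phi_+\rangle_{A_jB_j}=(|00\rangle+|11\rangle)/\sqrt2$, $|\Phi_+\rangle_{AB}=\bigotimes_{j}|\Phi_+\rangle_{A_jB_j}$, $\rho_{AB}(U,V)=(U_A\otimes V^*_B)|\Phi_+\rangle\langle\Phi_+|_{AB}(U_A\otimes V^*_B)^\dagger$, and $\Pi_j=|\Phi_+\rangle\langle\Phi_+|_{A_jB_j}$ (tensored with the identity). For real $L'$ let $\Lambda^{(L',j)}=\{j'\in\Lambda: |j-j'|\le L'/2\}$, $H^{(L',j)}=\sum_{X\subseteq\Lambda^{(L',j)}}h_X$ and $U^{(L',j)}=e^{-iH^{(L',j)}\tau}\otimes I_{\Lambda\setminus\Lambda^{(L',j)}}$. Then: (a) There are $v,\xi,c>0$, depending only on $g,k,d_H$, such that for every $\tau\ge0$ the LR bound with velocity $v$, length $\xi$ and prefactor $c(1+\tau)$ holds at time $\tau$. (b) For every $\xi>0$ there is $K>0$, depending only on $\xi,g,k,d_H$, with the following property. Let $v,\tau\ge0$ and $C$ be such that the LR bound with $v,\xi,C$ holds at time $\tau$. For any real $l_0$ put $$L'=2(l_0+d_H+v\tau),\qquad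 \varepsilon_{\mathrm{LR}}=C'\int_{L'/2-d_H}^{\infty}e^{-(x-v\tau)/\xi}\,dx,\qquad C'=K\tau C.$$ Then $\varepsilon_{\mathrm{LR}}=C'\xi\,e^{-l_0/\xi}$, and for every $L$, every $(g,k,d_H)$-local $H^{(L)}$ and every site $j$: $$\big\|U^{(L)\dagger}O_jU^{(L)}-U^{(L',j)\dagger}O_jU^{(L',j)}\big\|\le\varepsilon_{\mathrm{LR}}$$ for every observable $O_j$ on the site $j$ with $\|O_j\|=1$, and for every unitary $V^{(L)}$ on $\Lambda$ $$\big|C^{(j)}_{\mathrm{LHST}}(U^{(L)},V^{(L)})-C^{(j)}_{\mathrm{LHST}}(U^{(L',j)},V^{(L)})\big|\le\tfrac34\,\varepsilon_{\mathrm{LR}}.$$ In particular $C^{(j)}_{\mathrm{LHST}}(U^{(L)},V^{(L)})\le C^{(j)}_{\mathrm{LHST}}(U^{(L',j)},V^{(L)})+\tfrac34\varepsilon_{\mathrm{LR}}$. -/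

import Mathlib

open scoped Matrix.Norms.L2Operator Kronecker Matrix

noncomputable section

namespace LocalCompilation

/-- Operators on the qubits labelled by `ι`: the Hilbert space has the computational basis
`ι → Fin 2`. The norm is the operator norm induced by the Hilbert space norm. -/
abbrev Op (ι : Type) : Type := Matrix (ι → Fin 2) (ι → Fin 2) ℂ

open Classical in
/-- For qubits `ι` placed among the qubits `κ` by `f`, the operator `B ⊗ I` on the qubits `κ`:
`B` acts on the qubits in the range of `f` and the identity acts on all the others. -/
def extend {ι κ : Type} (f : ι ↪ κ) (B : Op ι) : Op κ :=
  fun σ σ' =>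
    if ∀ y, y ∉ Set.range f → σ y = σ' y then B (fun x => σ (f x)) (fun x => σ' (f x)) else 0

/-- The single-qubit operator `O` acting on the site `j` of an `L`-qubit chain. -/
def onSite {L : ℕ} (j : Fin L) (O : Matrix (Fin 2) (Fin 2) ℂ) : Op (Fin L) :=
  fun σ σ' => if ∀ i, i ≠ j → σ i = σ' i then O (σ j) (σ' j) else 0

/-- The distance between two sites of the chain. -/
def siteDist {L : ℕ} (i j : Fin L) : ℝ := |((i : ℕ) : ℝ) - ((j : ℕ) : ℝ)|

/-- Interaction terms on an `L`-qubit chain: for every domain `X`, an operator `h X` on the qubits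
of `X`. -/
abbrev Interaction (L : ℕ) : Type := (X : Finset (Fin L)) → Op X

/-- Hermitian interaction terms that are extensive with local energy scale `g`, at most `k`-body,
and of range at most `dH`. -/
structure IsLocal {L : ℕ} (g : ℝ) (k : ℕ) (dH : ℝ) (h : Interaction L) : Prop where
  hermitian : ∀ X, (h X).IsHermitian
  extensive : ∀ j : Fin L, ∑ X : Finset (Fin L) with j ∈ X, ‖h X‖ ≤ g
  local_body : ∀ X : Finset (Fin L), k < X.card → h X = 0
  finite_range : ∀ X : Finset (Fin L), (∃ i ∈ X, ∃ j ∈ X, dH < siteDist i j) → h X = 0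

/-- The Hamiltonian `∑_{X ⊆ Λ} h_X` of the whole chain. -/
def hamiltonian {L : ℕ} (h : Interaction L) : Op (Fin L) :=
  ∑ X : Finset (Fin L), extend (Function.Embedding.subtype (· ∈ X)) (h X)

/-- The Hamiltonian `∑_{X ⊆ W} h_X` restricted to the domain `W`, as an operator on the qubits
of `W` only. -/
def restrictedHamiltonian {L : ℕ} (h : Interaction L) (W : Finset (Fin L)) : Op W :=
  ∑ X : {X : Finset (Fin L) // X ⊆ W},
    extend (Subtype.impEmbedding (· ∈ X.1) (· ∈ W) (fun _ hx => X.2 hx)) (h X.1)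

/-- The time evolution operator `e^{-i H τ}`. -/
def evolution {ι : Type} [Fintype ι] [DecidableEq ι] (H : Op ι) (τ : ℝ) : Op ι :=
  NormedSpace.exp ((-(Complex.I * (τ : ℂ))) • H)

/-- The domain of the sites at distance at most `L' / 2` from `j`. -/
def window {L : ℕ} (L' : ℝ) (j : Fin L) : Finset (Fin L) :=
  Finset.univ.filter fun i => siteDist j i ≤ L' / 2

/-- The evolution operator `U^{(L)} = e^{-i H τ}` of the whole chain. -/
def fullEvolution {L : ℕ} (h : Interaction L) (τ : ℝ) : Op (Fin L) :=
  evolution (hamiltonian h) τ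

/-- The evolution operator `U^{(L',j)} = e^{-i H^{(L',j)} τ} ⊗ I` generated by the Hamiltonian
restricted to the window around `j`. -/
def windowEvolution {L : ℕ} (h : Interaction L) (L' : ℝ) (j : Fin L) (τ : ℝ) : Op (Fin L) :=
  extend (Function.Embedding.subtype (· ∈ window L' j))
    (evolution (restrictedHamiltonian h (window L' j)) τ)

/-- The Lieb-Robinson bound at time `τ`, with velocity `v`, length `ξ` and prefactor `C`, for all
Hamiltonians with the parameters `g`, `k`, `dH` on chains of any length. -/
def LiebRobinsonBound (g : ℝ) (k : ℕ) (dH v ξ C τ : ℝ) : Prop :=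
  ∀ (L : ℕ) (h : Interaction L), IsLocal g k dH h →
    ∀ (j j' : Fin L) (O O' : Matrix (Fin 2) (Fin 2) ℂ),
      O.IsHermitian → O'.IsHermitian → ‖O‖ = 1 → ‖O'‖ = 1 →
        ‖⁅(fullEvolution h τ)ᴴ * onSite j O * fullEvolution h τ, onSite j' O'⁆‖
          ≤ C * Real.exp (-(siteDist j j' - v * τ) / ξ)

/-- `ε_LR = C' ∫_{L'/2 - dH}^∞ e^{-(x - v τ)/ξ} dx`. -/
def epsLR (C' dH v ξ τ L' : ℝ) : ℝ :=
  C' * ∫ x in Set.Ioi (L' / 2 - dH), Real.exp (-(x - v * τ) / ξ)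

/-- The amplitudes of the Bell pair `(|00⟩ + |11⟩)/√2`. -/
def bellPair (a b : Fin 2) : ℂ := if a = b then ((1 / Real.sqrt 2 : ℝ) : ℂ) else 0

/-- The state `|Φ₊⟩_{AB} = ⨂_j |Φ₊⟩_{A_j B_j}` of the doubled chain; the basis of the doubled chain
is indexed by pairs (configuration of `A`, configuration of `B`). -/
def bellState (L : ℕ) : (Fin L → Fin 2) × (Fin L → Fin 2) → ℂ :=
  fun p => ∏ j, bellPair (p.1 j) (p.2 j)

/-- `ρ_{AB}(U,V) = (U_A ⊗ V*_B) |Φ₊⟩⟨Φ₊| (U_A ⊗ V*_B)†`, with `V*` the entrywise conjugate. -/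
def rhoAB {L : ℕ} (U V : Op (Fin L)) :
    Matrix ((Fin L → Fin 2) × (Fin L → Fin 2)) ((Fin L → Fin 2) × (Fin L → Fin 2)) ℂ :=
  (U ⊗ₖ V.map star) * Matrix.vecMulVec (bellState L) (star (bellState L)) * (U ⊗ₖ V.map star)ᴴ

/-- `Π_j`: the projection `|Φ₊⟩⟨Φ₊|` on the pair `A_j B_j`, tensored with the identity on all the
other qubits. -/
def bellProj {L : ℕ} (j : Fin L) :
    Matrix ((Fin L → Fin 2) × (Fin L → Fin 2)) ((Fin L → Fin 2) × (Fin L → Fin 2)) ℂ :=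
  fun p q =>
    if ∀ i, i ≠ j → p.1 i = q.1 i ∧ p.2 i = q.2 i then
      bellPair (p.1 j) (p.2 j) * star (bellPair (q.1 j) (q.2 j)) else 0

/-- The local cost `C_LHST^{(j)}(U,V) = 1 - Tr[Π_j ρ_{AB}(U,V)]`. The trace is a real number,
`Π_j` and `ρ_{AB}` being positive semidefinite. -/
def localCost {L : ℕ} (j : Fin L) (U V : Op (Fin L)) : ℝ :=
  1 - (Matrix.trace (bellProj j * rhoAB U V)).re

end LocalCompilation

end

/-! Both parts reduce to commutators with single-site matrix units. An operator on `X` is a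
combination of `4 ^ X.card` matrix units, each a product of single-site ones. By the Leibniz rule
its commutator with `A` is therefore controlled by commutators of `A` with the sites of `X`
(`norm_lie_extend_le`).

For (a), consider the commutators of all evolved single-site matrix units with a fixed observable at
`j'`, in a sup norm weighted by the exponential of the distance to `j'`. The Jacobi identity and the
finite range of the terms bound the derivative of this family by a constant times its norm
(`norm_lie_lie_hamiltonian_onSite_le`). Grönwall's inequality then gives exponential growth in time
and exponential decay in distance, uniformly in the length of the chain.

For (b), a Duhamel interpolation bounds the truncation error by the commutators, at times `s < τ`,
of the evolved observable with the discarded terms. The bound assumed at time `τ` covers all earlier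
times, because evolving for time `s` is evolving for time `τ` under the Hamiltonian scaled by `s /
τ`, which is still local. Each discarded term touches a site outside the window, so a geometric
series over those sites gives the error (`LiebRobinsonBound.norm_sub_le`). For the cost, the Bell
projection is a quarter of the sum of `P ⊗ P*` over the four Pauli matrices. The identity
contributes nothing to the difference and each other Pauli at most a quarter of the error, whence
3/4. -/

noncomputable section

namespace LocalCompilation

/-! ### Heisenberg dynamics and commutator estimates in a C*-algebra. -/

section Heisenberg

variable {A : Type*} [CStarAlgebra A]

/-- The Heisenberg evolution `e^{iHt} X e^{-iHt}`. -/
def heisenberg (H : A) (t : ℝ) (X : A) : A :=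
  NormedSpace.exp ((Complex.I * (t : ℂ)) • H) * X *
    NormedSpace.exp ((-(Complex.I * (t : ℂ))) • H)

theorem exp_smul_mul_exp_neg_smul (H : A) (z : ℂ) :
    NormedSpace.exp (z • H) * NormedSpace.exp ((-z) • H) = 1 := by
  let _ : NormedAlgebra ℚ A := NormedAlgebra.restrictScalars ℚ ℂ A
  have hc : Commute (z • H) ((-z) • H) := ((Commute.refl H).smul_left z).smul_right (-z)
  rw [← NormedSpace.exp_add_of_commute hc, ← add_smul]
  simp

theorem exp_neg_smul_mul_exp_smul (H : A) (z : ℂ) :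
    NormedSpace.exp ((-z) • H) * NormedSpace.exp (z • H) = 1 := by
  simpa using exp_smul_mul_exp_neg_smul H (-z)

theorem heisenberg_zero (H X : A) : heisenberg H 0 X = X := by
  simp [heisenberg]

theorem heisenberg_sub (H : A) (t : ℝ) (X Y : A) :
    heisenberg H t (X - Y) = heisenberg H t X - heisenberg H t Y := by
  simp [heisenberg, mul_sub, sub_mul]

theorem heisenberg_smul (H : A) (t : ℝ) (c : ℂ) (X : A) :
    heisenberg H t (c • X) = c • heisenberg H t X := by
  simp [heisenberg]

theorem heisenberg_mul (H : A) (t : ℝ) (X Y : A) :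
    heisenberg H t (X * Y) = heisenberg H t X * heisenberg H t Y := by
  have h := exp_neg_smul_mul_exp_smul H (Complex.I * (t : ℂ))
  simp only [heisenberg]
  calc _ = NormedSpace.exp ((Complex.I * (t : ℂ)) • H) * X * 1 * Y *
        NormedSpace.exp ((-(Complex.I * (t : ℂ))) • H) := by simp only [mul_one, mul_assoc]
    _ = _ := by rw [← h]; simp only [mul_assoc]

theorem heisenberg_lie (H : A) (t : ℝ) (X Y : A) :
    heisenberg H t ⁅X, Y⁆ = ⁅heisenberg H t X, heisenberg H t Y⁆ := by
  simp only [Ring.lie_def, heisenberg_sub, heisenberg_mul]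

theorem heisenberg_neg_heisenberg (H : A) (t : ℝ) (X : A) :
    heisenberg H t (heisenberg H (-t) X) = X := by
  have h := exp_smul_mul_exp_neg_smul H (Complex.I * (t : ℂ))
  simp only [heisenberg, Complex.ofReal_neg, mul_neg, neg_neg]
  calc _ = (NormedSpace.exp ((Complex.I * (t : ℂ)) • H) *
          NormedSpace.exp ((-(Complex.I * (t : ℂ))) • H)) * X *
        (NormedSpace.exp ((Complex.I * (t : ℂ)) • H) *
          NormedSpace.exp ((-(Complex.I * (t : ℂ))) • H)) := by simp only [mul_assoc]
    _ = X := by rw [h]; simp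

theorem heisenberg_generator (H : A) (t : ℝ) : heisenberg H t H = H := by
  have hc : Commute (NormedSpace.exp ((Complex.I * (t : ℂ)) • H)) H :=
    ((Commute.refl H).smul_left _).exp_left
  rw [heisenberg, hc.eq, mul_assoc, exp_smul_mul_exp_neg_smul, mul_one]

theorem exp_smul_mem_unitary {H : A} (hH : IsSelfAdjoint H) (t : ℝ) :
    NormedSpace.exp ((Complex.I * (t : ℂ)) • H) ∈ unitary A := by
  have hs : star (NormedSpace.exp ((Complex.I * (t : ℂ)) • H)) =
      NormedSpace.exp ((-(Complex.I * (t : ℂ))) • H) := by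
    rw [NormedSpace.star_exp, star_smul, hH.star_eq]
    simp
  rw [Unitary.mem_iff, hs]
  exact ⟨exp_neg_smul_mul_exp_smul _ _, exp_smul_mul_exp_neg_smul _ _⟩

theorem star_exp_smul {H : A} (hH : IsSelfAdjoint H) (t : ℝ) :
    star (NormedSpace.exp ((-(Complex.I * (t : ℂ))) • H)) =
      NormedSpace.exp ((Complex.I * (t : ℂ)) • H) := by
  rw [NormedSpace.star_exp, star_smul, hH.star_eq]
  simp

theorem norm_heisenberg {H : A} (hH : IsSelfAdjoint H) (t : ℝ) (X : A) :
    ‖heisenberg H t X‖ = ‖X‖ := by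
  have h₁ := exp_smul_mem_unitary hH t
  have h₂ := exp_smul_mem_unitary hH (-t)
  simp only [Complex.ofReal_neg, mul_neg] at h₂
  rw [heisenberg, CStarRing.norm_mul_mem_unitary _ h₂, CStarRing.norm_mem_unitary_mul _ h₁]

/-- The evolution is an isometric automorphism, so it can be moved to the other entry of the
commutator with time reversed. -/
theorem norm_lie_heisenberg {H : A} (hH : IsSelfAdjoint H) (t : ℝ) (X B : A) :
    ‖⁅heisenberg H t X, B⁆‖ = ‖⁅X, heisenberg H (-t) B⁆‖ := by
  conv_lhs => rw [← heisenberg_neg_heisenberg H t B, ← heisenberg_lie, norm_heisenberg hH]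

theorem hasDerivAt_exp_smul (H : A) (c : ℂ) (t : ℝ) :
    HasDerivAt (fun s : ℝ => NormedSpace.exp ((c * (s : ℂ)) • H))
      (c • (NormedSpace.exp ((c * (t : ℂ)) • H) * H)) t := by
  have h := (hasDerivAt_exp_smul_const (𝕂 := ℂ) H (c * (t : ℂ))).scomp t
    (((hasDerivAt_id t).ofReal_comp).const_mul c)
  refine h.congr_deriv ?_
  simp

/-- The affine time `u + c * s` serves both the forward evolution (`u = 0`, `c = 1`) and the
backward leg of the Duhamel interpolation (`u = τ`, `c = -1`). -/
theorem hasDerivAt_heisenberg_comp (H : A) {Y : ℝ → A} {Y' : A} {t : ℝ} (u c : ℝ)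
    (hY : HasDerivAt Y Y' t) :
    HasDerivAt (fun s => heisenberg H (u + c * s) (Y s))
      (heisenberg H (u + c * t) (((c : ℂ) * Complex.I) • ⁅H, Y t⁆ + Y')) t := by
  have hu : HasDerivAt (fun s : ℝ => u + c * s) c t := by
    simpa using ((hasDerivAt_id t).const_mul c).const_add u
  have h₁ := (hasDerivAt_exp_smul H Complex.I (u + c * t)).scomp t hu
  have h₂ := (hasDerivAt_exp_smul H (-Complex.I) (u + c * t)).scomp t hu
  have hc : Commute H (NormedSpace.exp ((-Complex.I * ((u + c * t : ℝ) : ℂ)) • H)) :=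
    ((Commute.refl H).smul_right _).exp_right
  have h := (h₁.mul hY).mul h₂
  have e : ∀ s : ℝ, -Complex.I * ((u + c * s : ℝ) : ℂ) = -(Complex.I * ((u + c * s : ℝ) : ℂ)) :=
    fun s => neg_mul _ _
  simp only [Function.comp_apply, ← hc.eq] at h
  simp only [e] at h
  refine (h.congr_of_eventuallyEq (Filter.Eventually.of_forall fun s => ?_)).congr_deriv ?_
  · simp [heisenberg]
  have hr : ∀ X : A, c • X = (c : ℂ) • X := fun X => (Complex.coe_smul c X).symm
  simp only [heisenberg, Ring.lie_def, hr, Pi.mul_apply, Function.comp_apply, smul_sub, mul_add, add_mul, mul_sub, sub_mul, neg_smul,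
    smul_neg, mul_neg, smul_smul, mul_smul_comm, smul_mul_assoc, mul_assoc]
  abel

theorem hasDerivAt_heisenberg (H X : A) (t : ℝ) :
    HasDerivAt (fun s => heisenberg H s X) (heisenberg H t (Complex.I • ⁅H, X⁆)) t := by
  simpa using hasDerivAt_heisenberg_comp H 0 1 (hasDerivAt_const t X)

/-- Two Heisenberg evolutions of `X` differ by at most the integrated commutator of the evolved `X`
with the difference of the Hamiltonians. -/
theorem norm_heisenberg_sub_heisenberg_le (H : A) {H' : A} (hH' : IsSelfAdjoint H') (X : A)
    {τ D : ℝ} (hτ : 0 ≤ τ)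
    (hD : ∀ s, 0 ≤ s → s < τ → ‖⁅H - H', heisenberg H s X⁆‖ ≤ D) :
    ‖heisenberg H τ X - heisenberg H' τ X‖ ≤ D * τ := by
  -- Interpolate by evolving with `H` for time `s`, then with `H'` for the remaining `τ - s`. The
  -- outer evolution is isometric, so only the commutator with `H - H'` enters the derivative bound.
  have hf : ∀ s, HasDerivAt (fun s => heisenberg H' (τ + (-1) * s) (heisenberg H s X))
      (heisenberg H' (τ + (-1) * s) (Complex.I • ⁅H - H', heisenberg H s X⁆)) s := by
    intro s
    refine (hasDerivAt_heisenberg_comp H' τ (-1) (hasDerivAt_heisenberg H X s)).congr_deriv ?_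
    rw [heisenberg_smul H, heisenberg_lie, heisenberg_generator]
    congr 1
    simp only [Ring.lie_def, sub_mul, mul_sub, smul_sub, Complex.ofReal_neg, Complex.ofReal_one,
      neg_mul, one_mul, neg_smul]
    abel
  have h := norm_image_sub_le_of_norm_deriv_le_segment' (a := 0) (b := τ) (C := D)
    (fun s _ => (hf s).hasDerivWithinAt) (fun s hs => by
      rw [norm_heisenberg hH', norm_smul, Complex.norm_I, one_mul]
      exact hD s hs.1 hs.2) τ ⟨hτ, le_rfl⟩
  simpa [heisenberg_zero] using h

theorem norm_lie_le (X Y : A) : ‖⁅X, Y⁆‖ ≤ 2 * ‖X‖ * ‖Y‖ := by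
  rw [Ring.lie_def]
  calc _ ≤ ‖X * Y‖ + ‖Y * X‖ := norm_sub_le _ _
    _ ≤ ‖X‖ * ‖Y‖ + ‖Y‖ * ‖X‖ := add_le_add (norm_mul_le _ _) (norm_mul_le _ _)
    _ = _ := by ring

theorem norm_lie_comm (X Y : A) : ‖⁅X, Y⁆‖ = ‖⁅Y, X⁆‖ := by
  rw [Ring.lie_def, Ring.lie_def, norm_sub_rev]

theorem smul_lie_eq (c : ℂ) (X Y : A) : ⁅c • X, Y⁆ = c • ⁅X, Y⁆ := by
  rw [Ring.lie_def, Ring.lie_def, smul_sub, smul_mul_assoc, mul_smul_comm]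

theorem sum_lie_eq {ι : Type*} (s : Finset ι) (X : ι → A) (Y : A) :
    ⁅∑ i ∈ s, X i, Y⁆ = ∑ i ∈ s, ⁅X i, Y⁆ := by
  simp only [Ring.lie_def, Finset.sum_mul, Finset.mul_sum, Finset.sum_sub_distrib]

/-- By the Jacobi identity, `B` meets only `X` or `Y` alone; this is what closes the differential
inequality below. -/
theorem norm_lie_lie_le (X Y B : A) :
    ‖⁅⁅X, Y⁆, B⁆‖ ≤ 2 * ‖Y‖ * ‖⁅X, B⁆‖ + 2 * ‖X‖ * ‖⁅Y, B⁆‖ := by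
  have h : ⁅⁅X, Y⁆, B⁆ = ⁅X, ⁅Y, B⁆⁆ - ⁅Y, ⁅X, B⁆⁆ := by
    simp only [Ring.lie_def]
    noncomm_ring
  rw [h]
  refine (norm_sub_le _ _).trans ?_
  linarith [norm_lie_le X ⁅Y, B⁆, norm_lie_le Y ⁅X, B⁆]

end Heisenberg

/-! ### Tensoring with the identity as a star homomorphism. -/

section Extend

variable {ι κ : Type}

open Classical in
theorem extend_apply (f : ι ↪ κ) (B : Op ι) (σ σ' : κ → Fin 2) :
    extend f B σ σ' = if ∀ y, y ∉ Set.range f → σ y = σ' y then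
      B (fun x => σ (f x)) (fun x => σ' (f x)) else 0 := rfl

-- Configurations that agree with `σ` off the range of `f` are parametrised by their values on the
-- range. This collapses the matrix product of two extended operators to a sum over `ι → Fin 2`.
open Classical in
theorem sum_ite_eq_sum_extend [Fintype ι] [Fintype κ] [DecidableEq ι] [DecidableEq κ] (f : ι ↪ κ) (σ : κ → Fin 2)
    (F : (κ → Fin 2) → ℂ) :
    (∑ σ' : κ → Fin 2, if ∀ y, y ∉ Set.range f → σ y = σ' y then F σ' else 0) =
      ∑ a : ι → Fin 2, F (Function.extend f a σ) := by
  rw [← Finset.sum_filter]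
  refine Finset.sum_nbij' (fun σ' x => σ' (f x)) (fun a => Function.extend f a σ)
    (fun _ _ => Finset.mem_univ _) (fun a _ => ?_) (fun σ' hσ' => ?_) (fun a _ => ?_)
    (fun σ' hσ' => ?_)
  · simp only [Finset.mem_filter, Finset.mem_univ, true_and]
    intro y hy
    rw [Function.extend_apply' _ _ _ (by simpa using hy)]
  · funext y
    simp only [Finset.mem_filter, Finset.mem_univ, true_and] at hσ'
    by_cases hy : y ∈ Set.range f
    · obtain ⟨x, rfl⟩ := hy
      rw [f.injective.extend_apply]
    · rw [Function.extend_apply' _ _ _ (by simpa using hy), hσ' y hy]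
  · funext x
    rw [f.injective.extend_apply]
  · congr 1
    funext y
    simp only [Finset.mem_filter, Finset.mem_univ, true_and] at hσ'
    by_cases hy : y ∈ Set.range f
    · obtain ⟨x, rfl⟩ := hy
      rw [f.injective.extend_apply]
    · rw [Function.extend_apply' _ _ _ (by simpa using hy), hσ' y hy]

theorem extend_mul [Fintype ι] [Fintype κ] [DecidableEq ι] [DecidableEq κ] (f : ι ↪ κ) (A B : Op ι) :
    extend f (A * B) = extend f A * extend f B := by
  classical
  ext σ σ''
  have h := sum_ite_eq_sum_extend f σ
    (fun σ' => A (fun x => σ (f x)) (fun x => σ' (f x)) * extend f B σ' σ'')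
  rw [Matrix.mul_apply]
  refine (?_ : extend f (A * B) σ σ'' = _).trans
    ((Finset.sum_congr rfl fun σ' _ => ?_ : _ = _).trans h).symm
  swap
  · rw [extend_apply f A]
    split_ifs <;> simp
  have e' : ∀ a : ι → Fin 2, (∀ y, y ∉ Set.range f → Function.extend f a σ y = σ'' y) ↔
      ∀ y, y ∉ Set.range f → σ y = σ'' y := fun a =>
    forall₂_congr fun y hy => by rw [Function.extend_apply' _ _ _ (by simpa using hy)]
  simp only [extend_apply, f.injective.extend_apply, e', Matrix.mul_apply]
  split_ifs <;> simp

theorem extend_one [DecidableEq ι] [DecidableEq κ] [Fintype ι] [Fintype κ] (f : ι ↪ κ) :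
    extend f (1 : Op ι) = 1 := by
  classical
  ext σ σ'
  simp only [extend_apply, Matrix.one_apply]
  by_cases h : σ = σ'
  · subst h
    simp
  · rw [if_neg h]
    split_ifs with h₁ h₂
    · refine absurd (funext fun y => ?_) h
      by_cases hy : y ∈ Set.range f
      · obtain ⟨x, rfl⟩ := hy
        exact congrFun h₂ x
      · exact h₁ y hy
    · rfl
    · rfl

theorem extend_add (f : ι ↪ κ) (A B : Op ι) : extend f (A + B) = extend f A + extend f B := by
  ext σ σ'
  simp only [extend_apply, Matrix.add_apply]
  split_ifs <;> simp

theorem extend_smul (f : ι ↪ κ) (c : ℂ) (A : Op ι) : extend f (c • A) = c • extend f A := by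
  ext σ σ'
  simp only [extend_apply, Matrix.smul_apply]
  split_ifs <;> simp

theorem extend_conjTranspose (f : ι ↪ κ) (A : Op ι) : extend f Aᴴ = (extend f A)ᴴ := by
  ext σ σ'
  simp only [extend_apply, Matrix.conjTranspose_apply]
  have h : (∀ y, y ∉ Set.range f → σ y = σ' y) ↔ ∀ y, y ∉ Set.range f → σ' y = σ y :=
    forall₂_congr fun _ _ => eq_comm
  by_cases h' : ∀ y, y ∉ Set.range f → σ y = σ' y
  · rw [if_pos h', if_pos (h.1 h')]
  · rw [if_neg h', if_neg (h.not.1 h'), star_zero]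

theorem extend_extend {μ : Type} (f : ι ↪ κ) (f' : κ ↪ μ) (A : Op ι) :
    extend f' (extend f A) = extend (f.trans f') A := by
  ext σ σ'
  simp only [extend_apply, Function.Embedding.trans_apply]
  have h : ((∀ y, y ∉ Set.range f' → σ y = σ' y) ∧
      ∀ y, y ∉ Set.range f → σ (f' y) = σ' (f' y)) ↔
        ∀ y, y ∉ Set.range (f.trans f') → σ y = σ' y := by
    constructor
    · rintro ⟨h₁, h₂⟩ y hy
      by_cases hy' : y ∈ Set.range f'
      · obtain ⟨x, rfl⟩ := hy'
        refine h₂ x fun ⟨z, hz⟩ => hy ⟨z, ?_⟩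
        simp [hz]
      · exact h₁ y hy'
    · intro h
      refine ⟨fun y hy => h y fun ⟨z, hz⟩ => hy ⟨f z, by simpa using hz⟩, fun y hy =>
        h _ fun ⟨z, hz⟩ => hy ⟨z, f'.injective (by simpa using hz)⟩⟩
  by_cases h' : ∀ y, y ∉ Set.range (f.trans f') → σ y = σ' y
  · rw [if_pos (h.2 h').1, if_pos (h.2 h').2, if_pos h']
  · rw [if_neg h']
    split_ifs with h₁ h₂
    · exact absurd (h.1 ⟨h₁, h₂⟩) h'
    · rfl
    · rfl

variable [Fintype ι] [Fintype κ] [DecidableEq ι] [DecidableEq κ]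

/-- Tensoring with the identity, as a homomorphism of star algebras. -/
def extendHom (f : ι ↪ κ) : Op ι →⋆ₐ[ℂ] Op κ where
  toFun := extend f
  map_one' := extend_one f
  map_mul' := extend_mul f
  map_zero' := by simpa using extend_smul f 0 0
  map_add' := extend_add f
  commutes' c := by
    rw [Algebra.algebraMap_eq_smul_one, Algebra.algebraMap_eq_smul_one, extend_smul, extend_one]
  map_star' := extend_conjTranspose f

theorem extendHom_apply (f : ι ↪ κ) (A : Op ι) : extendHom f A = extend f A := rfl

theorem norm_extend_le (f : ι ↪ κ) (A : Op ι) : ‖extend f A‖ ≤ ‖A‖ :=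
  NonUnitalStarAlgHom.norm_apply_le (extendHom f) A

theorem extend_evolution (f : ι ↪ κ) (H : Op ι) (τ : ℝ) :
    extend f (evolution H τ) = evolution (extend f H) τ := by
  have hc : Continuous (extendHom f) :=
    (extendHom f).toAlgHom.toLinearMap.continuous_of_finiteDimensional
  let _ : NormedAlgebra ℚ (Op ι) := NormedAlgebra.restrictScalars ℚ ℂ (Op ι)
  have h := NormedSpace.map_exp (extendHom f) hc ((-(Complex.I * (τ : ℂ))) • H)
  rw [map_smul] at h
  exact h

end Extend

/-! ### Single-site operators and their products. -/

section OnSite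

variable {L : ℕ}

theorem onSite_eq_extend (j : Fin L) (O : Matrix (Fin 2) (Fin 2) ℂ) :
    onSite j O = extend ⟨fun _ : Unit => j, fun _ _ _ => rfl⟩
      (O.submatrix (Equiv.funUnique Unit (Fin 2)) (Equiv.funUnique Unit (Fin 2))) := by
  ext σ σ'
  simp only [onSite, extend, Matrix.submatrix_apply]
  simp only [Set.mem_range, not_exists, Equiv.funUnique_apply]
  refine if_congr (forall_congr' fun y => imp_congr_left ⟨fun h _ => Ne.symm h, fun h => Ne.symm (h ())⟩) rfl rfl

/-- Single-site operators, as a homomorphism of star algebras. -/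
def onSiteHom (j : Fin L) : Matrix (Fin 2) (Fin 2) ℂ →⋆ₐ[ℂ] Op (Fin L) where
  toFun := onSite j
  map_one' := by rw [onSite_eq_extend, Matrix.submatrix_one_equiv, extend_one]
  map_mul' A B := by
    simp only [onSite_eq_extend]
    rw [← Matrix.submatrix_mul_equiv A B _ (Equiv.funUnique Unit (Fin 2)), extend_mul]
  map_zero' := by
    ext
    simp [onSite]
  map_add' A B := by
    ext
    simp only [onSite, Matrix.add_apply]
    split_ifs <;> simp
  commutes' c := by
    have h : onSite j (1 : Matrix (Fin 2) (Fin 2) ℂ) = 1 := by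
      rw [onSite_eq_extend, Matrix.submatrix_one_equiv, extend_one]
    rw [Algebra.algebraMap_eq_smul_one, Algebra.algebraMap_eq_smul_one, ← h]
    ext
    simp [onSite]
  map_star' A := by
    rw [onSite_eq_extend, onSite_eq_extend, Matrix.star_eq_conjTranspose,
      Matrix.star_eq_conjTranspose, ← Matrix.conjTranspose_submatrix, extend_conjTranspose]

theorem onSiteHom_apply (j : Fin L) (O : Matrix (Fin 2) (Fin 2) ℂ) :
    onSiteHom j O = onSite j O := rfl

theorem norm_onSite_le (j : Fin L) (O : Matrix (Fin 2) (Fin 2) ℂ) : ‖onSite j O‖ ≤ ‖O‖ :=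
  NonUnitalStarAlgHom.norm_apply_le (onSiteHom j) O

/-- The tensor product of the single-site operators `M i` over the sites `i ∈ S`. -/
def prodOn (S : Finset (Fin L)) (M : Fin L → Matrix (Fin 2) (Fin 2) ℂ) : Op (Fin L) :=
  fun σ σ' => if ∀ y, y ∉ S → σ y = σ' y then ∏ i ∈ S, M i (σ i) (σ' i) else 0

theorem prodOn_empty (M : Fin L → Matrix (Fin 2) (Fin 2) ℂ) : prodOn ∅ M = 1 := by
  ext σ σ'
  simp [prodOn, Matrix.one_apply, funext_iff]

theorem prodOn_insert {S : Finset (Fin L)} {i : Fin L} (hi : i ∉ S)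
    (M : Fin L → Matrix (Fin 2) (Fin 2) ℂ) :
    prodOn (insert i S) M = onSite i (M i) * prodOn S M := by
  ext σ σ''
  -- The only contributing intermediate configuration has already changed at `i` and nowhere else.
  rw [Matrix.mul_apply, Finset.sum_eq_single (Function.update σ i (σ'' i))]
  · have h₁ : ∀ y, y ≠ i → σ y = Function.update σ i (σ'' i) y := fun y hy => by
      rw [Function.update_of_ne hy]
    have h₂ : (∀ y, y ∉ S → Function.update σ i (σ'' i) y = σ'' y) ↔
        ∀ y, y ∉ insert i S → σ y = σ'' y := by
      refine forall_congr' fun y => ?_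
      by_cases hy : y = i
      · subst hy
        simp
      · simp [hy]
    have h₃ : ∏ y ∈ S, M y (Function.update σ i (σ'' i) y) (σ'' y) =
        ∏ y ∈ S, M y (σ y) (σ'' y) :=
      Finset.prod_congr rfl fun y hy => by
        rw [Function.update_of_ne (ne_of_mem_of_not_mem hy hi)]
    simp only [prodOn, onSite, if_pos h₁, h₂, h₃, Finset.prod_insert hi, Function.update_self,
      mul_ite, mul_zero]
  · intro σ' _ hσ'
    simp only [prodOn, onSite]
    split_ifs with h₁ h₂
    · refine absurd (funext fun y => ?_) hσ'
      by_cases hy : y = i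
      · subst hy
        simp [h₂ y hi]
      · simp [hy, h₁ y hy]
    all_goals simp
  · simp

theorem norm_prodOn_le_one (S : Finset (Fin L)) (M : Fin L → Matrix (Fin 2) (Fin 2) ℂ)
    (hM : ∀ i, ‖M i‖ ≤ 1) : ‖prodOn S M‖ ≤ 1 := by
  induction S using Finset.induction_on with
  | empty => rw [prodOn_empty, norm_one]
  | insert i S hi ih =>
    rw [prodOn_insert hi]
    exact (norm_mul_le _ _).trans
      (mul_le_one₀ ((norm_onSite_le _ _).trans (hM i)) (norm_nonneg _) ih)

/-- Leibniz rule, all remaining factors being contractions. -/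
theorem norm_lie_prodOn_le (S : Finset (Fin L)) (M : Fin L → Matrix (Fin 2) (Fin 2) ℂ)
    (hM : ∀ i, ‖M i‖ ≤ 1) (A : Op (Fin L)) :
    ‖⁅prodOn S M, A⁆‖ ≤ ∑ i ∈ S, ‖⁅onSite i (M i), A⁆‖ := by
  induction S using Finset.induction_on with
  | empty => simp [prodOn_empty, Ring.lie_def]
  | insert i S hi ih =>
    rw [prodOn_insert hi, Finset.sum_insert hi]
    have e : ⁅onSite i (M i) * prodOn S M, A⁆ =
        ⁅onSite i (M i), A⁆ * prodOn S M + onSite i (M i) * ⁅prodOn S M, A⁆ := by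
      simp only [Ring.lie_def]
      noncomm_ring
    rw [e]
    refine (norm_add_le _ _).trans (add_le_add ?_ ?_)
    · exact (norm_mul_le _ _).trans
        (mul_le_of_le_one_right (norm_nonneg _) (norm_prodOn_le_one S M hM))
    · refine (norm_mul_le _ _).trans ((mul_le_of_le_one_left (norm_nonneg _) ?_).trans ih)
      exact (norm_onSite_le _ _).trans (hM i)

theorem norm_single_le_one (a b : Fin 2) : ‖Matrix.single a b (1 : ℂ)‖ ≤ 1 := by
  have h : ‖Matrix.single a b (1 : ℂ)‖ * ‖Matrix.single a b (1 : ℂ)‖ = 1 := by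
    rw [← Matrix.l2_opNorm_conjTranspose_mul_self, Matrix.conjTranspose_single,
      Matrix.single_mul_single_same, ← Matrix.diagonal_single, Matrix.l2_opNorm_diagonal]
    rw [Pi.norm_single]
    simp
  nlinarith [norm_nonneg (Matrix.single a b (1 : ℂ))]

theorem norm_entry_le {n : Type*} [Fintype n] [DecidableEq n] (A : Matrix n n ℂ) (a b : n) :
    ‖A a b‖ ≤ ‖A‖ := by
  have h := A.l2_opNorm_mulVec (EuclideanSpace.single b (1 : ℂ))
  have h' := (EuclideanSpace.norm_eq _).symm.le.trans h
  have h₃ := PiLp.norm_apply_le ((EuclideanSpace.equiv n ℂ).symm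
    (A.mulVec (EuclideanSpace.single b (1 : ℂ)))) a
  simpa using h₃.trans h

end OnSite

/-! ### Commutators with interaction terms, and scaling of interactions. -/

section Interaction

variable {L : ℕ}

/-- Both orders of multiplication equal `prodOn` over the unordered pair of sites. -/
theorem onSite_commute {i j : Fin L} (hij : i ≠ j) (M N : Matrix (Fin 2) (Fin 2) ℂ) :
    onSite i M * onSite j N = onSite j N * onSite i M := by
  let F : Fin L → Matrix (Fin 2) (Fin 2) ℂ := fun x => if x = i then M else N
  have hi : F i = M := if_pos rfl
  have hj : F j = N := if_neg hij.symm
  have h : ∀ x, prodOn {x} F = onSite x (F x) := fun x => by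
    rw [← insert_empty_eq, prodOn_insert (Finset.notMem_empty x), prodOn_empty, mul_one]
  rw [← hi, ← hj, ← h j, ← prodOn_insert (by simpa using hij), Finset.pair_comm,
    prodOn_insert (by simpa using hij.symm), h, h]

theorem extend_single_eq_prodOn (X : Finset (Fin L)) (a b : X → Fin 2) :
    extend (Function.Embedding.subtype (· ∈ X)) (Matrix.single a b 1) =
      prodOn X fun i => if hi : i ∈ X then Matrix.single (a ⟨i, hi⟩) (b ⟨i, hi⟩) 1 else 0 := by
  ext σ σ'
  rw [extend_apply, prodOn]
  have hX : (∀ y, y ∉ Set.range (Function.Embedding.subtype (· ∈ X)) → σ y = σ' y) ↔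
      ∀ y, y ∉ X → σ y = σ' y := forall_congr' fun y => by simp
  by_cases h : ∀ y, y ∉ X → σ y = σ' y
  swap
  · rw [if_neg h, if_neg (hX.not.2 h)]
  rw [if_pos h, if_pos (hX.2 h), ← Finset.prod_coe_sort]
  simp only [Finset.coe_mem, dite_true, Matrix.single_apply, Function.Embedding.subtype_apply,
    Subtype.coe_eta]
  rw [Finset.prod_ite_zero]
  simp [funext_iff, forall_and]

/-- Expand `B` in matrix units: there are `4 ^ X.card` of them, with coefficients at most `‖B‖`, and
each is a product of single-site matrix units. -/
theorem norm_lie_extend_le (X : Finset (Fin L)) (B : Op X) (A : Op (Fin L)) {N : Fin L → ℝ}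
    (hN : ∀ i ∈ X, ∀ a b, ‖⁅onSite i (Matrix.single a b 1), A⁆‖ ≤ N i) :
    ‖⁅extend (Function.Embedding.subtype (· ∈ X)) B, A⁆‖ ≤
      4 ^ X.card * ‖B‖ * ∑ i ∈ X, N i := by
  have e : ⁅extend (Function.Embedding.subtype (· ∈ X)) B, A⁆ = ∑ a, ∑ b, B a b •
      ⁅extend (Function.Embedding.subtype (· ∈ X)) (Matrix.single a b 1), A⁆ := by
    conv_lhs => rw [Matrix.matrix_eq_sum_single B]
    simp only [← extendHom_apply, map_sum, sum_lie_eq, ← smul_lie_eq, ← map_smul, Matrix.smul_single,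
      smul_eq_mul, mul_one]
  have hab : ∀ a b : X → Fin 2,
      ‖⁅extend (Function.Embedding.subtype (· ∈ X)) (Matrix.single a b 1), A⁆‖ ≤
        ∑ i ∈ X, N i := by
    intro a b
    rw [extend_single_eq_prodOn]
    refine (norm_lie_prodOn_le _ _ (fun i => ?_) A).trans (Finset.sum_le_sum fun i hi => ?_)
    · split_ifs
      · exact norm_single_le_one _ _
      · simp
    · rw [dif_pos hi]
      exact hN i hi _ _
  rw [e]
  calc _ ≤ ∑ a : X → Fin 2, ∑ b : X → Fin 2, ‖B‖ * ∑ i ∈ X, N i := by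
        refine norm_sum_le_of_le _ fun a _ => norm_sum_le_of_le _ fun b _ => ?_
        rw [norm_smul]
        exact mul_le_mul (norm_entry_le B a b) (hab a b) (norm_nonneg _) (norm_nonneg _)
    _ = _ := by
        simp only [Finset.sum_const, Finset.card_univ, Fintype.card_fun, Fintype.card_coe,
          Fintype.card_fin, nsmul_eq_mul]
        push_cast
        rw [show (4 : ℝ) = 2 * 2 by norm_num, mul_pow]
        ring

/-- The term `h_X` of an interaction, acting on the whole chain. -/
def term (h : Interaction L) (X : Finset (Fin L)) : Op (Fin L) :=
  extend (Function.Embedding.subtype (· ∈ X)) (h X)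

theorem hamiltonian_eq_sum_term (h : Interaction L) : hamiltonian h = ∑ X, term h X := rfl

theorem lie_term_onSite (h : Interaction L) {X : Finset (Fin L)} {j : Fin L} (hj : j ∉ X)
    (O : Matrix (Fin 2) (Fin 2) ℂ) : ⁅term h X, onSite j O⁆ = 0 := by
  have h' := norm_lie_extend_le X (h X) (onSite j O) (N := fun _ => 0) fun i hi a b => by
    rw [Ring.lie_def, onSite_commute (ne_of_mem_of_not_mem hi hj), sub_self, norm_zero]
  simpa [term] using h'

theorem lie_hamiltonian_onSite (h : Interaction L) (j : Fin L) (O : Matrix (Fin 2) (Fin 2) ℂ) :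
    ⁅hamiltonian h, onSite j O⁆ = ∑ X with j ∈ X, ⁅term h X, onSite j O⁆ := by
  rw [Finset.sum_filter_of_ne fun X _ hX => by_contra fun hj => hX (lie_term_onSite h hj O),
    hamiltonian_eq_sum_term]
  exact sum_lie_eq _ _ _

theorem siteDist_comm (i j : Fin L) : siteDist i j = siteDist j i := abs_sub_comm _ _

theorem siteDist_triangle (i j m : Fin L) : siteDist i m ≤ siteDist i j + siteDist j m :=
  abs_sub_le _ _ _

namespace IsLocal

variable {g : ℝ} {k : ℕ} {dH : ℝ} {h : Interaction L}

theorem isSelfAdjoint_term (hh : IsLocal g k dH h) (X : Finset (Fin L)) :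
    IsSelfAdjoint (term h X) :=
  IsSelfAdjoint.map (show IsSelfAdjoint (h X) from hh.hermitian X)
    (extendHom (Function.Embedding.subtype (· ∈ X)))

theorem isSelfAdjoint_hamiltonian (hh : IsLocal g k dH h) : IsSelfAdjoint (hamiltonian h) :=
  isSelfAdjoint_sum _ fun X _ => hh.isSelfAdjoint_term X

/-- Together with `fullEvolution_smul`, this trades a shorter time for a weaker interaction. -/
theorem smul (hh : IsLocal g k dH h) {r : ℝ} (hr₀ : 0 ≤ r) (hr₁ : r ≤ 1) :
    IsLocal g k dH fun X => (r : ℂ) • h X where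
  hermitian X := (hh.hermitian X).smul (Complex.conj_ofReal r)
  extensive j := by
    refine (Finset.sum_le_sum fun X _ => ?_).trans (hh.extensive j)
    rw [norm_smul, Complex.norm_real, Real.norm_of_nonneg hr₀]
    exact mul_le_of_le_one_left (norm_nonneg _) hr₁
  local_body X hX := by simp [hh.local_body X hX]
  finite_range X hX := by simp [hh.finite_range X hX]

theorem norm_lie_term_le (hh : IsLocal g k dH h) {X : Finset (Fin L)} {j : Fin L} (hj : j ∈ X)
    {A : Op (Fin L)} {c : ℝ} (hc : 0 ≤ c)
    (hA : ∀ i, siteDist j i ≤ dH → ∀ a b, ‖⁅onSite i (Matrix.single a b 1), A⁆‖ ≤ c) :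
    ‖⁅term h X, A⁆‖ ≤ 4 ^ k * k * c * ‖h X‖ := by
  by_cases hX : h X = 0
  · have h₀ : term h X = 0 := by
      rw [term, hX, ← extendHom_apply, map_zero]
    simp [h₀, hX, Ring.lie_def]
  · have hk : X.card ≤ k := not_lt.1 fun h' => hX (hh.local_body X h')
    have hr : ∀ i ∈ X, siteDist j i ≤ dH := fun i hi =>
      not_lt.1 fun h' => hX (hh.finite_range X ⟨j, hj, i, hi, h'⟩)
    refine (norm_lie_extend_le X (h X) A (N := fun _ => c) fun i hi => hA i (hr i hi)).trans ?_
    rw [Finset.sum_const, nsmul_eq_mul]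
    have h₁ : (4 : ℝ) ^ X.card ≤ 4 ^ k := pow_le_pow_right₀ (by norm_num) hk
    have h₂ : (X.card : ℝ) ≤ k := by exact_mod_cast hk
    calc _ ≤ 4 ^ k * ‖h X‖ * (k * c) := by gcongr
      _ = _ := by ring

theorem sum_norm_lie_term_le (hh : IsLocal g k dH h) (j : Fin L)
    {A : Op (Fin L)} {c : ℝ} (hc : 0 ≤ c)
    (hA : ∀ i, siteDist j i ≤ dH → ∀ a b, ‖⁅onSite i (Matrix.single a b 1), A⁆‖ ≤ c) :
    ∑ X with j ∈ X, ‖⁅term h X, A⁆‖ ≤ 4 ^ k * k * c * g := by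
  calc _ ≤ ∑ X with j ∈ X, 4 ^ k * k * c * ‖h X‖ :=
        Finset.sum_le_sum fun X hX =>
          hh.norm_lie_term_le (Finset.mem_filter.1 hX).2 hc hA
    _ ≤ _ := by
        rw [← Finset.mul_sum]
        exact mul_le_mul_of_nonneg_left (hh.extensive j) (by positivity)

end IsLocal

theorem fullEvolution_conj {h : Interaction L} (hH : IsSelfAdjoint (hamiltonian h)) (τ : ℝ)
    (O : Op (Fin L)) :
    (fullEvolution h τ)ᴴ * O * fullEvolution h τ = heisenberg (hamiltonian h) τ O := by
  rw [fullEvolution, evolution, ← Matrix.star_eq_conjTranspose, star_exp_smul hH, heisenberg]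

theorem fullEvolution_smul (h : Interaction L) (r τ : ℝ) :
    fullEvolution (fun X => (r : ℂ) • h X) τ = fullEvolution h (r * τ) := by
  have e : hamiltonian (fun X => (r : ℂ) • h X) = (r : ℂ) • hamiltonian h := by
    simp only [hamiltonian, extend_smul, Finset.smul_sum]
  rw [fullEvolution, fullEvolution, evolution, evolution, e, smul_smul]
  congr 2
  push_cast
  ring

theorem norm_lie_onSite_le_sum (j : Fin L) (O : Matrix (Fin 2) (Fin 2) ℂ) (A : Op (Fin L)) {c : ℝ}
    (hA : ∀ a b, ‖⁅onSite j (Matrix.single a b 1), A⁆‖ ≤ c) :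
    ‖⁅onSite j O, A⁆‖ ≤ 4 * ‖O‖ * c := by
  have e : ⁅onSite j O, A⁆ = ∑ a, ∑ b, O a b • ⁅onSite j (Matrix.single a b 1), A⁆ := by
    conv_lhs => rw [Matrix.matrix_eq_sum_single O]
    simp only [← onSiteHom_apply, map_sum, sum_lie_eq, ← smul_lie_eq, ← map_smul, Matrix.smul_single,
      smul_eq_mul, mul_one]
  rw [e]
  calc _ ≤ ∑ _a : Fin 2, ∑ _b : Fin 2, ‖O‖ * c := by
        refine norm_sum_le_of_le _ fun a _ => norm_sum_le_of_le _ fun b _ => ?_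
        rw [norm_smul]
        exact mul_le_mul (norm_entry_le O a b) (hA a b) (norm_nonneg _) (norm_nonneg _)
    _ = _ := by
        simp
        ring

end Interaction

/-! ### The Lieb-Robinson bound by a Grönwall argument. -/

section LiebRobinson

variable {L : ℕ} {g : ℝ} {k : ℕ} {dH : ℝ} {h : Interaction L}

/-- The rate in the Lieb-Robinson estimate. -/
def liebRobinsonRate (g : ℝ) (k : ℕ) (dH : ℝ) : ℝ := 2 * g * (4 ^ k * k * Real.exp dH + 1)

theorem liebRobinsonRate_nonneg (hg : 0 ≤ g) : 0 ≤ liebRobinsonRate g k dH := by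
  unfold liebRobinsonRate
  positivity

/-- Only terms through `j` survive in the inner commutator. The Jacobi identity leaves two
contributions: the terms themselves, whose sites lie within `dH` of `j` and so cost a factor `exp
dH` in the weight, and the matrix unit at `j`, responsible for the `+ 1` in the rate. -/
theorem norm_lie_lie_hamiltonian_onSite_le (hh : IsLocal g k dH h) (j j' : Fin L)
    (B : Op (Fin L)) {F : ℝ} (hF : 0 ≤ F)
    (hB : ∀ i a b, ‖⁅onSite i (Matrix.single a b 1), B⁆‖ ≤ Real.exp (-siteDist i j') * F)
    (a b : Fin 2) :
    ‖⁅⁅hamiltonian h, onSite j (Matrix.single a b 1)⁆, B⁆‖ ≤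
      Real.exp (-siteDist j j') * (liebRobinsonRate g k dH * F) := by
  set E := onSite j (Matrix.single a b (1 : ℂ)) with hE
  have hE₁ : ‖E‖ ≤ 1 := (norm_onSite_le _ _).trans (norm_single_le_one _ _)
  have e : ⁅⁅hamiltonian h, E⁆, B⁆ = ∑ X with j ∈ X, ⁅⁅term h X, E⁆, B⁆ := by
    rw [hE, lie_hamiltonian_onSite, sum_lie_eq]
  have h₁ : ∑ X with j ∈ X, ‖⁅term h X, B⁆‖ ≤
      4 ^ k * k * (Real.exp dH * (Real.exp (-siteDist j j') * F)) * g := by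
    refine hh.sum_norm_lie_term_le j (by positivity) fun i hi a b => (hB i a b).trans ?_
    rw [← mul_assoc, ← Real.exp_add]
    refine mul_le_mul_of_nonneg_right (Real.exp_le_exp.2 ?_) hF
    linarith [siteDist_triangle j i j']
  rw [e]
  calc _ ≤ ∑ X with j ∈ X, (2 * ‖⁅term h X, B⁆‖ + 2 * ‖h X‖ * (Real.exp (-siteDist j j') * F)) := by
        refine norm_sum_le_of_le _ fun X _ => (norm_lie_lie_le _ _ _).trans (add_le_add ?_ ?_)
        · exact mul_le_mul_of_nonneg_right (by linarith) (norm_nonneg _)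
        · exact mul_le_mul (mul_le_mul_of_nonneg_left (norm_extend_le _ _) (by norm_num))
            (hB j a b) (norm_nonneg _) (by positivity)
    _ = 2 * (∑ X with j ∈ X, ‖⁅term h X, B⁆‖) +
        2 * (∑ X with j ∈ X, ‖h X‖) * (Real.exp (-siteDist j j') * F) := by
        rw [Finset.sum_add_distrib, ← Finset.mul_sum, ← Finset.sum_mul, ← Finset.mul_sum]
    _ ≤ 2 * (4 ^ k * k * (Real.exp dH * (Real.exp (-siteDist j j') * F)) * g) +
        2 * g * (Real.exp (-siteDist j j') * F) := by
        gcongr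
        exact hh.extensive j
    _ = _ := by
        unfold liebRobinsonRate
        ring

theorem norm_lie_heisenberg_single_le (hg : 0 ≤ g) (hh : IsLocal g k dH h) (j j' : Fin L)
    {O' : Matrix (Fin 2) (Fin 2) ℂ} (hO' : ‖O'‖ ≤ 1) (a b : Fin 2) {t : ℝ} (ht : 0 ≤ t) :
    ‖⁅heisenberg (hamiltonian h) t (onSite j (Matrix.single a b 1)), onSite j' O'⁆‖ ≤
      2 * Real.exp (liebRobinsonRate g k dH * t - siteDist j j') := by
  set H := hamiltonian h
  set B := onSite j' O'
  have hH : IsSelfAdjoint H := hh.isSelfAdjoint_hamiltonian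
  have hB : ‖B‖ ≤ 1 := (norm_onSite_le _ _).trans hO'
  -- All sites and matrix units are tracked together, since the derivative at one site involves its
  -- neighbours. The weight `w` turns spatial decay into a bound on a sup norm.
  let E : Fin L × Fin 2 × Fin 2 → Op (Fin L) := fun p => onSite p.1 (Matrix.single p.2.1 p.2.2 1)
  let w : Fin L × Fin 2 × Fin 2 → ℝ := fun p => Real.exp (siteDist p.1 j')
  let f : ℝ → Fin L × Fin 2 × Fin 2 → Op (Fin L) := fun t p => w p • ⁅heisenberg H t (E p), B⁆
  let f' : ℝ → Fin L × Fin 2 × Fin 2 → Op (Fin L) := fun t p =>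
    w p • ⁅heisenberg H t (Complex.I • ⁅H, E p⁆), B⁆
  have hw : ∀ p, ‖w p‖ = w p := fun p => Real.norm_of_nonneg (Real.exp_nonneg _)
  have hderiv : ∀ t, HasDerivAt f (f' t) t := by
    intro t
    rw [hasDerivAt_pi]
    intro p
    have hp := hasDerivAt_heisenberg H (E p) t
    exact ((hp.mul_const B).sub (hp.const_mul B)).const_smul (w p)
  have hEf : ∀ t p, ‖⁅E p, heisenberg H (-t) B⁆‖ ≤ Real.exp (-siteDist p.1 j') * ‖f t‖ := by
    intro t p
    have h₁ : w p * ‖⁅E p, heisenberg H (-t) B⁆‖ ≤ ‖f t‖ := by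
      have := norm_le_pi_norm (f t) p
      rwa [show f t p = w p • ⁅heisenberg H t (E p), B⁆ from rfl, norm_smul, hw,
        norm_lie_heisenberg hH] at this
    rw [Real.exp_neg, ← div_eq_inv_mul, le_div_iff₀' (Real.exp_pos _)]
    exact h₁
  have hbound : ∀ t, ‖f' t‖ ≤ liebRobinsonRate g k dH * ‖f t‖ := by
    intro t
    refine (pi_norm_le_iff_of_nonneg
      (mul_nonneg (liebRobinsonRate_nonneg hg) (norm_nonneg _))).2 fun p => ?_
    have h₁ := norm_lie_lie_hamiltonian_onSite_le hh p.1 j' (heisenberg H (-t) B)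
      (norm_nonneg (f t)) (fun i a b => hEf t (i, a, b)) p.2.1 p.2.2
    rw [show f' t p = w p • ⁅heisenberg H t (Complex.I • ⁅H, E p⁆), B⁆ from rfl, norm_smul, hw,
      norm_lie_heisenberg hH]
    rw [smul_lie_eq, norm_smul, Complex.norm_I, one_mul, ← le_div_iff₀' (Real.exp_pos _), div_eq_inv_mul,
      ← Real.exp_neg]
    exact h₁
  have hzero : ‖f 0‖ ≤ 2 := by
    refine (pi_norm_le_iff_of_nonneg (by norm_num)).2 fun p => ?_
    rw [show f 0 p = w p • ⁅heisenberg H 0 (E p), B⁆ from rfl, heisenberg_zero]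
    -- At time zero only the site `j'` contributes, and there the weight is 1.
    by_cases hp : p.1 = j'
    · have h₁ : w p = 1 := by simp [w, hp, siteDist]
      rw [h₁, one_smul]
      refine (norm_lie_le _ _).trans ?_
      have h₂ : ‖E p‖ ≤ 1 := (norm_onSite_le _ _).trans (norm_single_le_one _ _)
      nlinarith [norm_nonneg (E p), norm_nonneg B]
    · rw [Ring.lie_def, onSite_commute hp, sub_self, smul_zero, norm_zero]
      norm_num
  have hG := norm_le_gronwallBound_of_norm_deriv_right_le (a := 0) (b := t) (ε := 0)
    (fun s _ => (hderiv s).continuousAt.continuousWithinAt)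
    (fun s _ => (hderiv s).hasDerivWithinAt) hzero
    (fun s _ => by rw [add_zero]; exact hbound s) t ⟨ht, le_rfl⟩
  rw [gronwallBound_ε0, sub_zero] at hG
  have h₁ := hEf t (j, a, b)
  rw [← norm_lie_heisenberg hH] at h₁
  refine h₁.trans ((mul_le_mul_of_nonneg_left hG (Real.exp_nonneg _)).trans (le_of_eq ?_))
  rw [sub_eq_add_neg, Real.exp_add]
  ring

/-- The 8 is the initial bound 2 times the four matrix units needed to expand `O`. The factor `1 +
τ` is slack, and the `+ 1` in the velocity keeps it positive when `g = 0`. -/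
theorem liebRobinsonBound_of_nonneg (hg : 0 ≤ g) {τ : ℝ} (hτ : 0 ≤ τ) :
    LiebRobinsonBound g k dH (liebRobinsonRate g k dH + 1) 1 (8 * (1 + τ)) τ := by
  intro L h hh j j' O O' _ _ hO hO'
  have hH := hh.isSelfAdjoint_hamiltonian
  rw [fullEvolution_conj hH, norm_lie_heisenberg hH]
  refine (norm_lie_onSite_le_sum j O _ fun a b => ?_).trans (?_ : 4 * ‖O‖ *
    (2 * Real.exp (liebRobinsonRate g k dH * τ - siteDist j j')) ≤ _)
  · rw [← norm_lie_heisenberg hH]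
    exact norm_lie_heisenberg_single_le hg hh j j' hO'.le a b hτ
  · rw [hO]
    have h₁ : Real.exp (liebRobinsonRate g k dH * τ - siteDist j j') ≤
        Real.exp (-(siteDist j j' - (liebRobinsonRate g k dH + 1) * τ) / 1) :=
      Real.exp_le_exp.2 (by linarith)
    nlinarith [Real.exp_pos (liebRobinsonRate g k dH * τ - siteDist j j')]

end LiebRobinson

/-! ### Exponential sums over the sites of the chain. -/

section GeometricSum

theorem sum_pow_le_of_injOn {ι : Type*} (s : Finset ι) (φ : ι → ℕ) (hφ : Set.InjOn φ s) {q : ℝ}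
    (hq₀ : 0 ≤ q) (hq₁ : q < 1) : ∑ i ∈ s, q ^ φ i ≤ (1 - q)⁻¹ := by
  classical
  rw [← Finset.sum_image (f := fun n => q ^ n) hφ, ← tsum_geometric_of_lt_one hq₀ hq₁]
  exact (summable_geometric_of_lt_one hq₀ hq₁).sum_le_tsum _ fun n _ => pow_nonneg hq₀ n

/-- Points at mutual distance at least 1 have distinct integer parts, so the sum is dominated by a
geometric series. -/
theorem sum_exp_neg_le_of_separated {ι : Type*} (s : Finset ι) (x : ι → ℝ) {ξ : ℝ} (hξ : 0 < ξ)
    (hx : ∀ i ∈ s, 0 ≤ x i) (hsep : ∀ i ∈ s, ∀ j ∈ s, i ≠ j → 1 ≤ |x i - x j|) :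
    ∑ i ∈ s, Real.exp (-x i / ξ) ≤ (1 - Real.exp (-1 / ξ))⁻¹ := by
  have hq : Real.exp (-1 / ξ) < 1 := by
    rw [Real.exp_lt_one_iff]
    exact div_neg_of_neg_of_pos (by norm_num) hξ
  refine le_trans (Finset.sum_le_sum fun i hi => ?_)
    (sum_pow_le_of_injOn s (fun i => ⌊x i⌋₊) (fun i hi j hj hij => ?_) (Real.exp_nonneg _) hq)
  · rw [← Real.exp_nat_mul, Real.exp_le_exp, mul_div_assoc', div_le_div_iff_of_pos_right hξ]
    linarith [Nat.floor_le (hx i hi)]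
  · by_contra hne
    have h := hsep i hi j hj hne
    have h₁ := Nat.floor_le (hx i hi)
    have h₂ := Nat.floor_le (hx j hj)
    have h₃ := Nat.lt_floor_add_one (x i)
    have h₄ := Nat.lt_floor_add_one (x j)
    simp only at hij
    rw [hij] at h₁ h₃
    rcases le_abs.1 h with h | h <;> linarith

theorem one_le_abs_sub_of_ne {L : ℕ} {i j : Fin L} (hij : i ≠ j) :
    1 ≤ |((i : ℕ) : ℝ) - ((j : ℕ) : ℝ)| := by
  have h : ((i : ℕ) : ℤ) - ((j : ℕ) : ℤ) ≠ 0 := by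
    rw [sub_ne_zero]
    exact_mod_cast Fin.val_ne_of_ne hij
  exact_mod_cast Int.one_le_abs h

theorem sum_exp_neg_siteDist_le {L : ℕ} (j : Fin L) (R : ℝ) {ξ : ℝ} (hξ : 0 < ξ) :
    ∑ i with R < siteDist j i, Real.exp (-(siteDist j i - R) / ξ) ≤
      2 * (1 - Real.exp (-1 / ξ))⁻¹ := by
  -- On each side of `j` the distances to `j` are 1-separated; across the two sides they may
  -- coincide, hence the factor 2.
  rw [← Finset.sum_filter_add_sum_filter_not _ (fun i => i ≤ j), two_mul]
  refine add_le_add ?_ ?_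
  · refine sum_exp_neg_le_of_separated _ _ hξ (fun i hi => ?_) fun i hi i' hi' hne => ?_
    · simp only [Finset.mem_filter] at hi
      linarith [hi.1.2]
    · simp only [Finset.mem_filter] at hi hi'
      have h₁ : ((i : ℕ) : ℝ) ≤ ((j : ℕ) : ℝ) := by exact_mod_cast hi.2
      have h₂ : ((i' : ℕ) : ℝ) ≤ ((j : ℕ) : ℝ) := by exact_mod_cast hi'.2
      rw [siteDist, siteDist, abs_of_nonneg (sub_nonneg.2 h₁), abs_of_nonneg (sub_nonneg.2 h₂)]
      refine (one_le_abs_sub_of_ne hne.symm).trans (le_of_eq (congrArg _ ?_))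
      ring
  · refine sum_exp_neg_le_of_separated _ _ hξ (fun i hi => ?_) fun i hi i' hi' hne => ?_
    · simp only [Finset.mem_filter] at hi
      linarith [hi.1.2]
    · simp only [Finset.mem_filter, not_le] at hi hi'
      have h₁ : ((j : ℕ) : ℝ) ≤ ((i : ℕ) : ℝ) := by exact_mod_cast hi.2.le
      have h₂ : ((j : ℕ) : ℝ) ≤ ((i' : ℕ) : ℝ) := by exact_mod_cast hi'.2.le
      rw [siteDist, siteDist, abs_of_nonpos (sub_nonpos.2 h₁), abs_of_nonpos (sub_nonpos.2 h₂)]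
      refine (one_le_abs_sub_of_ne hne).trans (le_of_eq (congrArg _ ?_))
      ring

end GeometricSum

/-! ### The error of restricting the Hamiltonian to a window. -/

section Window

variable {L : ℕ} {g : ℝ} {k : ℕ} {dH : ℝ} {h : Interaction L}

theorem extend_restrictedHamiltonian (h : Interaction L) (W : Finset (Fin L)) :
    extend (Function.Embedding.subtype (· ∈ W)) (restrictedHamiltonian h W) =
      ∑ X with X ⊆ W, term h X := by
  rw [restrictedHamiltonian, ← extendHom_apply, map_sum,
    Finset.sum_subtype (p := fun X => X ⊆ W) _ (by simp)]
  refine Finset.sum_congr rfl fun X _ => ?_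
  rw [extendHom_apply, extend_extend]
  rfl

theorem windowEvolution_eq (h : Interaction L) (L' : ℝ) (j : Fin L) (τ : ℝ) :
    windowEvolution h L' j τ = evolution (∑ X with X ⊆ window L' j, term h X) τ := by
  rw [windowEvolution, extend_evolution, extend_restrictedHamiltonian]

theorem IsLocal.isSelfAdjoint_sum_term (hh : IsLocal g k dH h) (s : Finset (Finset (Fin L))) :
    IsSelfAdjoint (∑ X ∈ s, term h X) :=
  isSelfAdjoint_sum _ fun X _ => hh.isSelfAdjoint_term X

theorem windowEvolution_conj (hh : IsLocal g k dH h) (L' : ℝ) (j : Fin L) (τ : ℝ)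
    (O : Op (Fin L)) :
    (windowEvolution h L' j τ)ᴴ * O * windowEvolution h L' j τ =
      heisenberg (∑ X with X ⊆ window L' j, term h X) τ O := by
  rw [windowEvolution_eq, evolution, ← Matrix.star_eq_conjTranspose,
    star_exp_smul (hh.isSelfAdjoint_sum_term _), heisenberg]

theorem evolution_mem_unitaryGroup {H : Op (Fin L)} (hH : IsSelfAdjoint H) (τ : ℝ) :
    evolution H τ ∈ Matrix.unitaryGroup (Fin L → Fin 2) ℂ := by
  have h' := exp_smul_mem_unitary hH (-τ)
  simp only [Complex.ofReal_neg, mul_neg] at h'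
  exact h'

theorem hamiltonian_sub_sum_term (h : Interaction L) (W : Finset (Fin L)) :
    hamiltonian h - ∑ X with X ⊆ W, term h X = ∑ X with ¬ X ⊆ W, term h X := by
  rw [hamiltonian_eq_sum_term, ← Finset.sum_filter_add_sum_filter_not _ (fun X => X ⊆ W),
    add_sub_cancel_left]

/-- Each discarded `X` contains a site outside `W`. Summing over all such sites overcounts,
harmlessly, and allows the extensivity bound to be applied site by site. -/
theorem norm_lie_hamiltonian_sub_le (W : Finset (Fin L)) (A : Op (Fin L)) :
    ‖⁅hamiltonian h - ∑ X with X ⊆ W, term h X, A⁆‖ ≤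
      ∑ i with i ∉ W, ∑ X with i ∈ X, ‖⁅term h X, A⁆‖ := by
  rw [hamiltonian_sub_sum_term, sum_lie_eq]
  have e : ∑ i with i ∉ W, ∑ X with i ∈ X, ‖⁅term h X, A⁆‖ =
      ∑ X, ∑ i with i ∉ W, if i ∈ X then ‖⁅term h X, A⁆‖ else 0 := by
    rw [Finset.sum_comm]
    exact Finset.sum_congr rfl fun i _ => Finset.sum_filter _ _
  rw [e]
  refine (norm_sum_le _ _).trans ((Finset.sum_le_sum fun X hX => ?_).trans
    (Finset.sum_le_univ_sum_of_nonneg fun X => Finset.sum_nonneg fun i _ => ?_))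
  · obtain ⟨i, hi, hiW⟩ := Finset.not_subset.1 (Finset.mem_filter.1 hX).2
    refine le_trans (le_of_eq (if_pos hi).symm) (Finset.single_le_sum
      (f := fun i => if i ∈ X then ‖⁅term h X, A⁆‖ else 0) (fun i _ => ?_)
      (Finset.mem_filter.2 ⟨Finset.mem_univ i, hiW⟩))
    positivity
  · positivity

variable {v ξ C τ : ℝ}

/-- Test the bound on the zero interaction of a one-qubit chain. -/
theorem LiebRobinsonBound.nonneg (hg : 0 ≤ g) (hLR : LiebRobinsonBound g k dH v ξ C τ) :
    0 ≤ C := by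
  have h₀ : IsLocal (L := 1) g k dH fun _ => 0 :=
    { hermitian := fun _ => Matrix.isHermitian_zero
      extensive := fun j => by simpa using hg
      local_body := fun _ _ => rfl
      finite_range := fun _ _ => rfl }
  have h := (norm_nonneg _).trans
    (hLR 1 _ h₀ 0 0 1 1 Matrix.isHermitian_one Matrix.isHermitian_one norm_one norm_one)
  exact nonneg_of_mul_nonneg_left h (Real.exp_pos _)

/-- Extends the hypothesis to earlier times, by scaling the interaction, and to non-Hermitian `O'`,
as matrix units require. The factor 2 comes from the real and imaginary parts of `O'`. -/
theorem LiebRobinsonBound.norm_lie_heisenberg_le (hLR : LiebRobinsonBound g k dH v ξ C τ)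
    (hg : 0 ≤ g) (hh : IsLocal g k dH h) (j j' : Fin L) {s : ℝ} (hs₀ : 0 ≤ s) (hsτ : s < τ)
    {O O' : Matrix (Fin 2) (Fin 2) ℂ} (hO : O.IsHermitian) (hO₁ : ‖O‖ = 1) (hO' : ‖O'‖ ≤ 1) :
    ‖⁅onSite j' O', heisenberg (hamiltonian h) s (onSite j O)⁆‖ ≤
      2 * (C * Real.exp (-(siteDist j j' - v * τ) / ξ)) := by
  set A := heisenberg (hamiltonian h) s (onSite j O) with hA
  set D := C * Real.exp (-(siteDist j j' - v * τ) / ξ)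
  have hD : 0 ≤ D := mul_nonneg (hLR.nonneg hg) (Real.exp_nonneg _)
  have hτ : 0 < τ := hs₀.trans_lt hsτ
  have key : ∀ P : Matrix (Fin 2) (Fin 2) ℂ, P.IsHermitian → ‖P‖ ≤ 1 → ‖⁅onSite j' P, A⁆‖ ≤ D := by
    intro P hP hP₁
    by_cases hP₀ : P = 0
    · rw [hP₀, ← onSiteHom_apply, map_zero]
      simpa [Ring.lie_def] using hD
    · have hn : 0 < ‖P‖ := norm_pos_iff.2 hP₀
      -- The hypothesis speaks only of observables of norm exactly 1, so `P` is normalised.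
      set P' : Matrix (Fin 2) (Fin 2) ℂ := ((‖P‖⁻¹ : ℝ) : ℂ) • P with hP'
      have hP'₁ : ‖P'‖ = 1 := by
        rw [hP', norm_smul, Complex.norm_real, Real.norm_of_nonneg (inv_nonneg.2 hn.le),
          inv_mul_cancel₀ hn.ne']
      have hP'h : P'.IsHermitian := hP.smul (Complex.conj_ofReal _)
      -- Scaling by `s / τ` makes the evolution at time `τ` equal to the original one at time `s`,
      -- while the right-hand side keeps `τ`.
      have h₁ := hLR L _ (hh.smul (div_nonneg hs₀ hτ.le) ((div_le_one hτ).2 hsτ.le)) j j' O P'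
        hO hP'h hO₁ hP'₁
      rw [fullEvolution_smul, div_mul_cancel₀ _ hτ.ne',
        fullEvolution_conj hh.isSelfAdjoint_hamiltonian, ← hA, norm_lie_comm] at h₁
      have h₂ : onSite j' P = ((‖P‖ : ℝ) : ℂ) • onSite j' P' := by
        rw [← onSiteHom_apply, ← onSiteHom_apply, ← map_smul, hP', smul_smul,
          ← Complex.ofReal_mul, mul_inv_cancel₀ hn.ne', Complex.ofReal_one, one_smul]
      rw [h₂, smul_lie_eq, norm_smul, Complex.norm_real, norm_norm]
      exact (mul_le_of_le_one_left (norm_nonneg _) hP₁).trans h₁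
  have hre : ‖(realPart O' : Matrix (Fin 2) (Fin 2) ℂ)‖ ≤ 1 := (realPart.norm_le O').trans hO'
  have him : ‖(imaginaryPart O' : Matrix (Fin 2) (Fin 2) ℂ)‖ ≤ 1 :=
    (imaginaryPart.norm_le O').trans hO'
  have e : ⁅onSite j' O', A⁆ = ⁅onSite j' (realPart O'), A⁆ +
      Complex.I • ⁅onSite j' (imaginaryPart O'), A⁆ := by
    conv_lhs => rw [← realPart_add_I_smul_imaginaryPart O']
    rw [← smul_lie_eq]
    simp only [← onSiteHom_apply, map_add, map_smul, Ring.lie_def, add_mul, mul_add]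
    abel
  rw [e]
  refine (norm_add_le _ _).trans ?_
  rw [norm_smul, Complex.norm_I, one_mul, two_mul]
  exact add_le_add (key _ (realPart O').2 hre) (key _ (imaginaryPart O').2 him)

/-- The prefactor in the estimate of the error caused by restricting the Hamiltonian. -/
def truncationConst (g : ℝ) (k : ℕ) (ξ : ℝ) : ℝ :=
  4 * (4 ^ k * k * g) * (1 - Real.exp (-1 / ξ))⁻¹

theorem LiebRobinsonBound.norm_sub_le (hLR : LiebRobinsonBound g k dH v ξ C τ)
    (hg : 0 ≤ g) (hξ : 0 < ξ) (hτ : 0 ≤ τ) (hh : IsLocal g k dH h) (j : Fin L)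
    {O : Matrix (Fin 2) (Fin 2) ℂ} (hO : O.IsHermitian) (hO₁ : ‖O‖ = 1) {l₀ L' : ℝ}
    (hL' : L' = 2 * (l₀ + dH + v * τ)) :
    ‖(fullEvolution h τ)ᴴ * onSite j O * fullEvolution h τ
        - (windowEvolution h L' j τ)ᴴ * onSite j O * windowEvolution h L' j τ‖ ≤
      truncationConst g k ξ * C * Real.exp (-l₀ / ξ) * τ := by
  have hC := hLR.nonneg hg
  rw [fullEvolution_conj hh.isSelfAdjoint_hamiltonian, windowEvolution_conj hh]
  refine norm_heisenberg_sub_heisenberg_le _ (hh.isSelfAdjoint_sum_term _) _ hτ fun s hs₀ hsτ => ?_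
  refine (norm_lie_hamiltonian_sub_le _ _).trans ?_
  calc _ ≤ ∑ i with i ∉ window L' j, 4 ^ k * k *
        (2 * C * Real.exp (-l₀ / ξ) * Real.exp (-(siteDist j i - L' / 2) / ξ)) * g := by
        refine Finset.sum_le_sum fun i _ => hh.sum_norm_lie_term_le i (by positivity)
          fun m hm a b => (hLR.norm_lie_heisenberg_le hg hh j m hs₀ hsτ hO hO₁
            (norm_single_le_one a b)).trans ?_
        rw [mul_assoc, mul_assoc, ← Real.exp_add, ← add_div]
        gcongr
        -- The site `m` may be closer to `j` than `i` by up to `dH`; the `dH` in `L' / 2 = l₀ + dH +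
        -- v * τ` absorbs this loss.
        have := siteDist_triangle j m i
        rw [siteDist_comm i m] at hm
        linarith
    _ = 2 * (4 ^ k * k * g) * C * Real.exp (-l₀ / ξ) *
        ∑ i with L' / 2 < siteDist j i, Real.exp (-(siteDist j i - L' / 2) / ξ) := by
        rw [Finset.mul_sum]
        refine Finset.sum_congr (by ext; simp [window]) fun i _ => ?_
        ring
    _ ≤ 2 * (4 ^ k * k * g) * C * Real.exp (-l₀ / ξ) * (2 * (1 - Real.exp (-1 / ξ))⁻¹) := by
        gcongr
        exact sum_exp_neg_siteDist_le j _ hξ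
    _ = _ := by
        unfold truncationConst
        ring

theorem truncationConst_nonneg (hg : 0 ≤ g) (hξ : 0 < ξ) : 0 ≤ truncationConst g k ξ := by
  have hq : Real.exp (-1 / ξ) ≤ 1 := by
    rw [Real.exp_le_one_iff]
    exact div_nonpos_of_nonpos_of_nonneg (by norm_num) hξ.le
  have := inv_nonneg.2 (sub_nonneg.2 hq)
  unfold truncationConst
  positivity

theorem epsLR_eq (C' : ℝ) {dH v ξ τ l₀ L' : ℝ} (hξ : 0 < ξ)
    (hL' : L' = 2 * (l₀ + dH + v * τ)) :
    epsLR C' dH v ξ τ L' = C' * ξ * Real.exp (-l₀ / ξ) := by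
  have hx : ∀ x : ℝ, Real.exp (-(x - v * τ) / ξ) =
      Real.exp (v * τ / ξ) * Real.exp (-ξ⁻¹ * x) := fun x => by
    rw [← Real.exp_add]
    congr 1
    field_simp
    ring
  have hl : -l₀ / ξ = v * τ / ξ + -ξ⁻¹ * (L' / 2 - dH) := by
    rw [hL']
    field_simp
    ring
  rw [epsLR]
  simp only [hx]
  rw [MeasureTheory.integral_const_mul, integral_exp_mul_Ioi (by simpa using hξ), hl, Real.exp_add]
  field_simp

end Window

/-! ### The local cost in terms of evolved Pauli operators. -/

section Cost

variable {L : ℕ}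

/-- The identity and the three Pauli matrices. -/
def pauli : Fin 4 → Matrix (Fin 2) (Fin 2) ℂ :=
  ![1, !![0, 1; 1, 0], !![0, -Complex.I; Complex.I, 0], !![1, 0; 0, -1]]

theorem isHermitian_pauli (P : Fin 4) : (pauli P).IsHermitian := by
  ext a b
  fin_cases P <;> fin_cases a <;> fin_cases b <;> simp [pauli, Matrix.conjTranspose_apply]

theorem pauli_mul_self (P : Fin 4) : pauli P * pauli P = 1 := by
  ext a b
  fin_cases P <;> fin_cases a <;> fin_cases b <;> simp [pauli, Matrix.mul_apply]

theorem norm_pauli (P : Fin 4) : ‖pauli P‖ = 1 := by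
  have h := Matrix.l2_opNorm_conjTranspose_mul_self (pauli P)
  rw [(isHermitian_pauli P).eq, pauli_mul_self, norm_one] at h
  nlinarith [norm_nonneg (pauli P)]

theorem bellPair_mul_star (a b c d : Fin 2) :
    bellPair a b * star (bellPair c d) =
      ∑ P, (1 / 4 : ℂ) * (pauli P a c * star (pauli P b d)) := by
  have h : (((1 / Real.sqrt 2 : ℝ) : ℂ)) * (((1 / Real.sqrt 2 : ℝ) : ℂ)) = 1 / 2 := by
    rw [← Complex.ofReal_mul, div_mul_div_comm, Real.mul_self_sqrt (by norm_num)]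
    push_cast
    norm_num
  have hs : star (((1 / Real.sqrt 2 : ℝ) : ℂ)) = ((1 / Real.sqrt 2 : ℝ) : ℂ) :=
    Complex.conj_ofReal _
  rw [Fin.sum_univ_four]
  unfold bellPair
  -- Only the reality of the amplitude and its square, 1/2, matter from here.
  generalize ((1 / Real.sqrt 2 : ℝ) : ℂ) = s at h hs
  fin_cases a <;> fin_cases b <;> fin_cases c <;> fin_cases d <;>
    simp [pauli, hs, h] <;> norm_num

theorem bellProj_eq_sum (j : Fin L) :
    bellProj j = ∑ P, (1 / 4 : ℂ) • (onSite j (pauli P) ⊗ₖ (onSite j (pauli P)).map star) := by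
  ext p q
  simp only [Matrix.sum_apply, Matrix.smul_apply, Matrix.kroneckerMap_apply, Matrix.map_apply,
    bellProj, onSite, bellPair_mul_star, smul_eq_mul]
  by_cases h₁ : ∀ i, i ≠ j → p.1 i = q.1 i
  · by_cases h₂ : ∀ i, i ≠ j → p.2 i = q.2 i
    · simp only [if_pos h₁, if_pos h₂, if_pos fun i hi => And.intro (h₁ i hi) (h₂ i hi)]
    · rw [if_neg fun h => h₂ fun i hi => (h i hi).2]
      simp [if_neg h₂]
  · rw [if_neg fun h => h₁ fun i hi => (h i hi).1]
    simp [if_neg h₁]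

theorem bellState_apply (p : (Fin L → Fin 2) × (Fin L → Fin 2)) :
    bellState L p = if p.1 = p.2 then ((1 / Real.sqrt 2 : ℝ) : ℂ) ^ L else 0 := by
  unfold bellState bellPair
  rw [Finset.prod_ite_zero]
  simp [funext_iff]

/-- The Bell state is supported on the diagonal with constant amplitude, so its expectation values
are normalised Hilbert-Schmidt pairings. -/
theorem star_bellState_dotProduct_mulVec (M N : Op (Fin L)) :
    star (bellState L) ⬝ᵥ (M ⊗ₖ N.map star) *ᵥ bellState L =
      (1 / 2 : ℂ) ^ L * Matrix.trace (M * Nᴴ) := by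
  have h : star (((1 / Real.sqrt 2 : ℝ) : ℂ) ^ L) * ((1 / Real.sqrt 2 : ℝ) : ℂ) ^ L =
      (1 / 2 : ℂ) ^ L := by
    rw [star_pow, show star (((1 / Real.sqrt 2 : ℝ) : ℂ)) = ((1 / Real.sqrt 2 : ℝ) : ℂ) from
      Complex.conj_ofReal _, ← mul_pow, ← Complex.ofReal_mul, div_mul_div_comm,
      Real.mul_self_sqrt (by norm_num)]
    push_cast
    norm_num
  simp only [dotProduct, Matrix.mulVec, Fintype.sum_prod_type, Pi.star_apply, bellState_apply,
    Matrix.kroneckerMap_apply, Matrix.map_apply, mul_ite, mul_zero, Finset.sum_ite_eq,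
    Finset.mem_univ, if_true, apply_ite (star : ℂ → ℂ), star_zero, ite_mul, zero_mul,
    Matrix.trace, Matrix.diag, Matrix.mul_apply, Matrix.conjTranspose_apply]
  rw [Finset.mul_sum]
  refine Finset.sum_congr rfl fun a _ => ?_
  rw [← Finset.sum_mul, mul_comm (∑ _, _), ← mul_assoc, h]

theorem trace_bellProj_mul_rhoAB (j : Fin L) (U V : Op (Fin L)) :
    Matrix.trace (bellProj j * rhoAB U V) = ∑ P, (1 / 4 : ℂ) * ((1 / 2 : ℂ) ^ L *
      Matrix.trace (Uᴴ * onSite j (pauli P) * U * (Vᴴ * onSite j (pauli P) * V)ᴴ)) := by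
  have hV : ∀ A B : Op (Fin L), (A * B).map star = A.map star * B.map star :=
    fun A B => Matrix.map_mul (f := starRingEnd ℂ)
  have hW : (U ⊗ₖ V.map star)ᴴ = Uᴴ ⊗ₖ Vᴴ.map star := by
    rw [Matrix.conjTranspose_kronecker]
    rfl
  rw [bellProj_eq_sum, Finset.sum_mul, Matrix.trace_sum]
  refine Finset.sum_congr rfl fun P _ => ?_
  rw [smul_mul_assoc, Matrix.trace_smul, smul_eq_mul, ← star_bellState_dotProduct_mulVec, hV, hV,
    Matrix.mul_kronecker_mul, Matrix.mul_kronecker_mul, rhoAB, Matrix.mul_vecMulVec,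
    Matrix.vecMulVec_mul, Matrix.mul_vecMulVec, Matrix.trace_vecMulVec, dotProduct_comm,
    ← Matrix.dotProduct_mulVec, Matrix.mulVec_mulVec, Matrix.mulVec_mulVec, hW]

theorem norm_trace_le (A : Op (Fin L)) : ‖Matrix.trace A‖ ≤ 2 ^ L * ‖A‖ := by
  refine (norm_sum_le_of_le _ fun a _ => norm_entry_le A a a).trans (le_of_eq ?_)
  simp

/-- Conjugating the identity by `U` or `U'` gives the same operator, so only three of the four Pauli
terms remain. In each, the factor `2 ^ L` bounding the trace cancels the normalisation of the Bell
state. -/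
theorem abs_localCost_sub_le (j : Fin L) {U U' V : Op (Fin L)}
    (hU : U ∈ Matrix.unitaryGroup (Fin L → Fin 2) ℂ)
    (hU' : U' ∈ Matrix.unitaryGroup (Fin L → Fin 2) ℂ)
    (hV : V ∈ Matrix.unitaryGroup (Fin L → Fin 2) ℂ) {ε : ℝ}
    (hε : ∀ O : Matrix (Fin 2) (Fin 2) ℂ, O.IsHermitian → ‖O‖ = 1 →
      ‖Uᴴ * onSite j O * U - U'ᴴ * onSite j O * U'‖ ≤ ε) :
    |localCost j U V - localCost j U' V| ≤ 3 / 4 * ε := by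
  let D : Fin 4 → Op (Fin L) := fun P =>
    Uᴴ * onSite j (pauli P) * U - U'ᴴ * onSite j (pauli P) * U'
  let N : Fin 4 → Op (Fin L) := fun P => Vᴴ * onSite j (pauli P) * V
  have hone : onSite j 1 = 1 := map_one (onSiteHom j)
  have hD₀ : D 0 = 0 := by
    have h₁ : Uᴴ * U = 1 := Matrix.mem_unitaryGroup_iff'.1 hU
    have h₂ : U'ᴴ * U' = 1 := Matrix.mem_unitaryGroup_iff'.1 hU'
    simp [D, pauli, hone, h₁, h₂]
  have hN : ∀ P, ‖N P‖ ≤ 1 := fun P => by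
    have h₁ : ‖N P‖ = ‖onSite j (pauli P)‖ := by
      rw [show N P = star V * onSite j (pauli P) * V from rfl, CStarRing.norm_mul_mem_unitary _ hV,
        CStarRing.norm_mem_unitary_mul _ (Unitary.star_mem hV)]
    rw [h₁, ← norm_pauli P]
    exact norm_onSite_le _ _
  have hterm : ∀ P, ‖(1 / 4 : ℂ) * ((1 / 2 : ℂ) ^ L * Matrix.trace (D P * (N P)ᴴ))‖ ≤
      1 / 4 * ‖D P‖ := fun P => by
    have h₁ : ‖D P * (N P)ᴴ‖ ≤ ‖D P‖ := (norm_mul_le _ _).trans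
      (mul_le_of_le_one_right (norm_nonneg _)
        ((Matrix.l2_opNorm_conjTranspose (N P)).trans_le (hN P)))
    have h₂ := (norm_trace_le (D P * (N P)ᴴ)).trans
      (mul_le_mul_of_nonneg_left h₁ (by positivity))
    have h₃ : (1 / 2 : ℝ) ^ L * 2 ^ L = 1 := by
      rw [← mul_pow]
      norm_num
    have h₄ : ‖(1 / 2 : ℂ)‖ = 1 / 2 := by norm_num
    have h₅ : ‖(1 / 4 : ℂ)‖ = 1 / 4 := by norm_num
    rw [norm_mul, norm_mul, norm_pow, h₄, h₅]
    refine mul_le_mul_of_nonneg_left ?_ (by norm_num)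
    calc _ ≤ (1 / 2 : ℝ) ^ L * (2 ^ L * ‖D P‖) :=
          mul_le_mul_of_nonneg_left h₂ (by positivity)
      _ = ‖D P‖ := by rw [← mul_assoc, h₃, one_mul]
  have e : localCost j U V - localCost j U' V =
      -(∑ P, (1 / 4 : ℂ) * ((1 / 2 : ℂ) ^ L * Matrix.trace (D P * (N P)ᴴ))).re := by
    have h₁ : Matrix.trace (bellProj j * rhoAB U V) - Matrix.trace (bellProj j * rhoAB U' V) =
        ∑ P, (1 / 4 : ℂ) * ((1 / 2 : ℂ) ^ L * Matrix.trace (D P * (N P)ᴴ)) := by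
      rw [trace_bellProj_mul_rhoAB, trace_bellProj_mul_rhoAB, ← Finset.sum_sub_distrib]
      refine Finset.sum_congr rfl fun P _ => ?_
      rw [← mul_sub, ← mul_sub, ← Matrix.trace_sub, ← sub_mul]
    rw [← h₁, Complex.sub_re, localCost, localCost]
    ring
  have hDε : ∀ P, ‖D P‖ ≤ ε := fun P => hε _ (isHermitian_pauli P) (norm_pauli P)
  rw [e, abs_neg]
  refine (Complex.abs_re_le_norm _).trans ((norm_sum_le_of_le _ fun P _ => hterm P).trans ?_)
  rw [Fin.sum_univ_four, hD₀, norm_zero]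
  linarith [hDε 1, hDε 2, hDε 3]

end Cost

end LocalCompilation

end

/-! ### Assembly of the two parts. -/

open LocalCompilation in
theorem proposition1 (g : ℝ) (hg : 0 ≤ g) (k : ℕ) (dH : ℝ) (hdH : 0 ≤ dH) :
    -- Lieb-Robinson constants exist, and depend on the Hamiltonian through `g`, `k`, `dH` only
    (∃ v ξ c : ℝ, 0 < v ∧ 0 < ξ ∧ 0 < c ∧
      ∀ τ : ℝ, 0 ≤ τ → LiebRobinsonBound g k dH v ξ (c * (1 + τ)) τ) ∧
    -- for all Lieb-Robinson constants, the restriction of the Hamiltonian costs little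
    (∀ ξ : ℝ, 0 < ξ → ∃ K : ℝ, 0 < K ∧
      ∀ v C τ : ℝ, 0 ≤ v → 0 ≤ τ → LiebRobinsonBound g k dH v ξ C τ →
        ∀ l₀ L' ε : ℝ, L' = 2 * (l₀ + dH + v * τ) → ε = epsLR (K * τ * C) dH v ξ τ L' →
          ε = K * τ * C * ξ * Real.exp (-l₀ / ξ) ∧
          ∀ (L : ℕ) (h : Interaction L), IsLocal g k dH h → ∀ j : Fin L,
            (∀ O : Matrix (Fin 2) (Fin 2) ℂ, O.IsHermitian → ‖O‖ = 1 →
              ‖(fullEvolution h τ)ᴴ * onSite j O * fullEvolution h τ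
                - (windowEvolution h L' j τ)ᴴ * onSite j O * windowEvolution h L' j τ‖ ≤ ε) ∧
            ∀ V : Op (Fin L), V ∈ Matrix.unitaryGroup (Fin L → Fin 2) ℂ →
              |localCost j (fullEvolution h τ) V - localCost j (windowEvolution h L' j τ) V|
                ≤ 3 / 4 * ε) := by
  refine ⟨⟨liebRobinsonRate g k dH + 1, 1, 8, ?_, one_pos, by norm_num,
    fun τ hτ => liebRobinsonBound_of_nonneg hg hτ⟩, fun ξ hξ => ?_⟩
  · linarith [liebRobinsonRate_nonneg (k := k) (dH := dH) hg]
  have hT : 0 ≤ truncationConst g k ξ := truncationConst_nonneg hg hξ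
  -- Division by `ξ` compensates the `ξ` produced by the integral; the `+ 1` keeps the constant
  -- positive when `g` or `k` vanishes.
  refine ⟨truncationConst g k ξ / ξ + 1, by positivity,
    fun v C τ _ hτ hLR l₀ L' ε hL' hε => ?_⟩
  rw [epsLR_eq _ hξ hL'] at hε
  refine ⟨hε, fun L h hh j => ?_⟩
  have hnorm : ∀ O : Matrix (Fin 2) (Fin 2) ℂ, O.IsHermitian → ‖O‖ = 1 →
      ‖(fullEvolution h τ)ᴴ * onSite j O * fullEvolution h τ
        - (windowEvolution h L' j τ)ᴴ * onSite j O * windowEvolution h L' j τ‖ ≤ ε := by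
    intro O hO hO₁
    refine (hLR.norm_sub_le hg hξ hτ hh j hO hO₁ hL').trans ?_
    have hC := hLR.nonneg hg
    have h₀ : 0 ≤ τ * C * ξ * Real.exp (-l₀ / ξ) := by positivity
    have h₁ : ε = truncationConst g k ξ * C * Real.exp (-l₀ / ξ) * τ +
        τ * C * ξ * Real.exp (-l₀ / ξ) := by
      rw [hε]
      field_simp
    linarith
  refine ⟨hnorm, fun V hV => abs_localCost_sub_le j
    (evolution_mem_unitaryGroup hh.isSelfAdjoint_hamiltonian τ) ?_ hV hnorm⟩
  rw [windowEvolution_eq]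
  exact evolution_mem_unitaryGroup (hh.isSelfAdjoint_sum_term _) τ
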